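/- Let $M$ be a smooth manifold of dimension $n\ge 3$ and let $F\colon TM\to[0,\infty)$ be a Finsler metric, i.e. $F$ is continuous on $TM$, smooth on the complement of the zero section, satisfies $F(tv)=tF(v)$ for all $t>0$, and, with $E=\tfrac12F^2$, the matrix $g_{ij}=\frac{\partial^2E}{\partial y^i\partial y^j}$ is positive definite at every non-zero tangent vector; here $(x^i,y^i)$ are the coordinates on $TM$ induced by a local coordinate system of $M$. Let $$G^l=\tfrac12 g^{lm}\left(y^k\frac{\partial^2E}{\partial y^m\partial x^k}-\frac{\partial E}{\partial x^m}\right)$$ be the geodesic spray coefficients of $F$ and let $$P^l_{ijk}=-\frac{\partial^3G^l}{\partial y^i\partial y^j\partial y^k}$$ be the mixed curvature tensor of the Berwald connection of $F$. Let $\alpha\colon M\to\mathbb R$ be a smooth function and $p\in M$ a point with $d_p\alpha\ne0$. Assume that the indicatrix hypersurface $\{v\in T_pM: F(v)=1\}$, with the Riemannian metric induced by $g_{ij}$, has positive sectional curvature (at all of its points and for all of its tangent planes). If the Finsler metrics $\tilde F=e^{\alpha}F$ and $F$ have the same mixed curvature tensor, $$\tilde P^l_{ijk}=P^l_{ijk}\qquad\text{at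 all non-zero tangent vectors of } M,$$ then $F$ is locally Riemannian at $p$: there are an open neighbourhood $U$ of $p$ and a smooth Riemannian metric $\gamma$ on $U$ such that $F(v)=\sqrt{\gamma(v,v)}$ for all $v\in TU$. -/

import Mathlib

open scoped Manifold ContDiff

noncomputable section

namespace Finsler

/-- The model space `ℝᵐ`. -/
abbrev Vec (m : ℕ) : Type := EuclideanSpace ℝ (Fin m)

/-- The `i`-th partial derivative of a real function on `ℝᵐ`. -/
def pd {m : ℕ} (i : Fin m) (f : Vec m → ℝ) (x : Vec m) : ℝ :=
  fderiv ℝ f x (EuclideanSpace.single i 1)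

/-! ### Sectional curvature of a Riemannian metric given in coordinates -/

section Riemann

variable {m : ℕ}

/-- Christoffel symbols `Γᶜ_{ab}` of the Levi-Civita connection of the metric `h_{ab}`. -/
def christoffel (h : Vec m → Matrix (Fin m) (Fin m) ℝ) (c a b : Fin m) (u : Vec m) : ℝ :=
  (1 / 2) * ∑ d, (h u)⁻¹ c d *
    (pd a (fun z => h z b d) u + pd b (fun z => h z a d) u - pd d (fun z => h z a b) u)

/-- Components of the curvature tensor, `R(∂_a, ∂_b) ∂_c = ∑ d, riemann h d c a b • ∂_d`. -/
def riemann (h : Vec m → Matrix (Fin m) (Fin m) ℝ) (d c a b : Fin m) (u : Vec m) : ℝ :=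
  pd a (christoffel h d b c) u - pd b (christoffel h d a c) u
    + ∑ e, (christoffel h d a e u * christoffel h e b c u
        - christoffel h d b e u * christoffel h e a c u)

/-- The scalar product `h_u(X, Y)`. -/
def metricInner (h : Vec m → Matrix (Fin m) (Fin m) ℝ) (u X Y : Vec m) : ℝ :=
  ∑ a, ∑ b, h u a b * X a * Y b

/-- The sectional curvature of the plane spanned by `X` and `Y`, that is
`⟨R(X,Y)Y, X⟩ / (⟨X,X⟩⟨Y,Y⟩ - ⟨X,Y⟩²)`. -/
def sectionalCurvature (h : Vec m → Matrix (Fin m) (Fin m) ℝ) (u X Y : Vec m) : ℝ :=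
  (∑ a, ∑ b, ∑ c, ∑ d, ∑ e, X a * Y b * Y c * riemann h d c a b u * h u d e * X e) /
    (metricInner h u X X * metricInner h u Y Y - metricInner h u X Y ^ 2)

end Riemann

/-! ### Finsler metrics -/

section Metric

variable {n : ℕ} {M : Type*} [TopologicalSpace M] [ChartedSpace (Vec n) M]

/-- The restriction to the tangent space at `q` of the energy `E = F² / 2`
(`TangentSpace (𝓡 n) q` is by definition the vector space `ℝⁿ`). -/
def energyAt (F : TangentBundle (𝓡 n) M → ℝ) (q : M) (v : Vec n) : ℝ :=
  (1 / 2) * F ⟨q, v⟩ ^ 2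

/-- The Riemann-Finsler metric `g_v(w, w')`: the Hessian at `v` of the energy on the tangent space
at `q`. -/
def fundamentalForm (F : TangentBundle (𝓡 n) M → ℝ) (q : M) (v w w' : Vec n) : ℝ :=
  fderiv ℝ (fun z => fderiv ℝ (energyAt F q) z w) v w'

/-- Finsler metric functions. -/
structure IsFinslerMetric [IsManifold (𝓡 n) ∞ M] (F : TangentBundle (𝓡 n) M → ℝ) : Prop where
  nonneg : ∀ v, 0 ≤ F v
  continuous : Continuous F
  smooth : ContMDiffOn (𝓡 n).tangent 𝓘(ℝ, ℝ) ∞ F {v | v.2 ≠ 0}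
  homogeneous : ∀ (q : M) (v : TangentSpace (𝓡 n) q) (t : ℝ), 0 < t → F ⟨q, t • v⟩ = t * F ⟨q, v⟩
  stronglyConvex : ∀ (q : M) (v : Vec n), v ≠ 0 →
    ∀ w : Vec n, w ≠ 0 → 0 < fundamentalForm F q v w w

/-- The conformal change `e^α F`. -/
def conformalChange (α : M → ℝ) (F : TangentBundle (𝓡 n) M → ℝ) (v : TangentBundle (𝓡 n) M) : ℝ :=
  Real.exp (α v.proj) * F v

/-! ### The mixed curvature of the Berwald connection in local coordinates -/

/-- The energy in the coordinates `(x, y)` of the tangent bundle that are induced by the chart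
`c`: here `y` stands for the tangent vector `∑ i, yⁱ ∂/∂uⁱ` at the point with coordinates `x`. -/
def coordEnergy (F : TangentBundle (𝓡 n) M → ℝ) (c : OpenPartialHomeomorph M (Vec n))
    (x y : Vec n) : ℝ :=
  (1 / 2) * F ⟨c.symm x, mfderiv (𝓡 n) (𝓡 n) c.symm x y⟩ ^ 2

/-- `g_{ij} = ∂²E / ∂yⁱ∂yʲ`. -/
def gCoord (E : Vec n → Vec n → ℝ) (x y : Vec n) : Matrix (Fin n) (Fin n) ℝ :=
  Matrix.of fun i j => pd j (pd i (E x)) y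

/-- Geodesic spray coefficients
`Gˡ = ½ gˡᵐ (yᵏ ∂²E / ∂yᵐ∂xᵏ - ∂E / ∂xᵐ)`. -/
def spray (E : Vec n → Vec n → ℝ) (l : Fin n) (x y : Vec n) : ℝ :=
  (1 / 2) * ∑ m, (gCoord E x y)⁻¹ l m *
    ((∑ k, y k * pd m (fun y' => pd k (fun x' => E x' y') x) y) - pd m (fun x' => E x' y) x)

/-- The mixed curvature `Pˡ_{ijk} = - ∂³Gˡ / ∂yⁱ∂yʲ∂yᵏ` of the Berwald connection. -/
def mixedCurvature (E : Vec n → Vec n → ℝ) (l i j k : Fin n) (x y : Vec n) : ℝ :=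
  - pd k (pd j (pd i (spray E l x))) y

/-- The mixed curvature tensors of the Berwald connections of `F₁` and `F₂` coincide: in every
local coordinate system they have the same components at all non-zero tangent vectors. -/
def SameMixedCurvature (F₁ F₂ : TangentBundle (𝓡 n) M → ℝ) : Prop :=
  ∀ c ∈ IsManifold.maximalAtlas (𝓡 n) ∞ M, ∀ x ∈ c.target, ∀ y : Vec n, y ≠ 0 →
    ∀ l i j k : Fin n,
      mixedCurvature (coordEnergy F₁ c) l i j k x y = mixedCurvature (coordEnergy F₂ c) l i j k x y

/-! ### The indicatrix -/

/-- `φ`, on the open set `W ⊆ ℝⁿ⁻¹`, is a smooth regular local parametrization of the indicatrix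
hypersurface `{v | F v = 1}` in the tangent space at `q`. -/
structure IsIndicatrixParam (F : TangentBundle (𝓡 n) M → ℝ) (q : M)
    (W : Set (Vec (n - 1))) (φ : Vec (n - 1) → Vec n) : Prop where
  isOpen : IsOpen W
  smooth : ContDiffOn ℝ ∞ φ W
  mem : ∀ u ∈ W, F ⟨q, φ u⟩ = 1
  immersion : ∀ u ∈ W, Function.Injective (fderiv ℝ φ u)

/-- The Riemannian metric induced on the indicatrix by the Riemann-Finsler metric, in the
parametrization `φ`: `h_{ab}(u) = g_{φ(u)}(∂_a φ, ∂_b φ)`. -/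
def inducedMetric (F : TangentBundle (𝓡 n) M → ℝ) (q : M) (φ : Vec (n - 1) → Vec n)
    (u : Vec (n - 1)) : Matrix (Fin (n - 1)) (Fin (n - 1)) ℝ :=
  Matrix.of fun a b => fundamentalForm F q (φ u)
    (fderiv ℝ φ u (EuclideanSpace.single a 1)) (fderiv ℝ φ u (EuclideanSpace.single b 1))

/-- The sectional curvature of the indicatrix hypersurface at `q` (all of its points and all
planes tangent to it) is positive. -/
def PositivelyCurvedIndicatrix (F : TangentBundle (𝓡 n) M → ℝ) (q : M) : Prop :=
  ∀ (W : Set (Vec (n - 1))) (φ : Vec (n - 1) → Vec n), IsIndicatrixParam F q W φ →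
    ∀ u ∈ W, ∀ X Y : Vec (n - 1), LinearIndependent ℝ ![X, Y] →
      0 < sectionalCurvature (inducedMetric F q φ) u X Y

/-! ### Riemannian metric functions -/

/-- `F` is Riemannian on the open set `U`: there `F v = √(γ(v, v))` for a smooth Riemannian
metric `γ`. -/
def IsRiemannianOn [IsManifold (𝓡 n) ∞ M] (F : TangentBundle (𝓡 n) M → ℝ) (U : Set M) : Prop :=
  ∃ γ : (q : M) → TangentSpace (𝓡 n) q →L[ℝ] TangentSpace (𝓡 n) q →L[ℝ] ℝ,
    ContMDiffOn (𝓡 n) ((𝓡 n).prod 𝓘(ℝ, Vec n →L[ℝ] Vec n →L[ℝ] ℝ)) ∞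
      (fun q => Bundle.TotalSpace.mk' (Vec n →L[ℝ] Vec n →L[ℝ] ℝ)
        (E := fun q : M => TangentSpace (𝓡 n) q →L[ℝ] TangentSpace (𝓡 n) q →L[ℝ] ℝ) q (γ q)) U ∧
    ∀ q ∈ U, (∀ v w, γ q v w = γ q w v) ∧ (∀ v, v ≠ 0 → 0 < γ q v v) ∧
      ∀ v, F ⟨q, v⟩ = Real.sqrt (γ q v v)

end Metric

end Finsler

end

/-!
Write `E = F² / 2` and let `y ↦ sharp E y` be the inverse of the metric `g_y`. Passing from `F` to
`e^α F` changes the spray by `Q y = dα(y) y - E(y) sharp E y dα`, which is positively homogeneous of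
degree two. If the mixed curvatures agree, the third fibre derivatives of `Q` vanish, so `Q` is
quadratic, and hence so is `2 E(y) sharp E y a = B y y`, where `a = dα` at a point with `dα ≠ 0`.

Let `y₀` minimise `E` on the hyperplane `a = 1`. Differentiating `g_y (B y y) = 2 E(y) a` gives
`B y₀ w = a(w) y₀`, and the component of `B h` along `ker a` is self-adjoint for `g_{y₀}`. If `e` is
an eigenvector of it with eigenvalue `l` and `g_{y₀}(h, e) ≠ 0`, then `dE(y₀)` vanishes at
`h + l y₀`; as `E` is strictly convex on the line `h + ℝ y₀`, there is at most one such `l`, so `h`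
itself is an eigenvector. Since `ker a` has dimension at least two, a polarisation argument then
shows that the tangential part of `B` is zero, i.e. that `2 E(y₀) B u w = g_{y₀}(u, w) y₀`. With
this value of `B`, the functions `E` and `g_{y₀}` have equal logarithmic derivatives, so they are
proportional, and `F` is Riemannian wherever `dα ≠ 0`.
-/

namespace Finsler

open Filter Set Module
open scoped Topology

section Homogeneous

variable {V W : Type*} [NormedAddCommGroup V] [NormedSpace ℝ V]
  [NormedAddCommGroup W] [NormedSpace ℝ W] {k : ℕ} {f g : V → W} {y : V}

/-- The second derivative, as a bilinear map; the differentiated slot comes first. -/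
noncomputable abbrev hessian (f : V → W) : V → V →L[ℝ] V →L[ℝ] W :=
  fderiv ℝ (fderiv ℝ f)

theorem contDiffAt_fderiv (hf : ContDiffAt ℝ ∞ f y) : ContDiffAt ℝ ∞ (fderiv ℝ f) y :=
  hf.fderiv_right (by simp)

theorem hessian_comm (hf : ContDiffAt ℝ ∞ f y) (u w : V) : hessian f y u w = hessian f y w u :=
  hf.isSymmSndFDerivAt (by simpa using ENat.LEInfty.out) u w

theorem fderiv_eq_of_forall_ne_zero {f' g' : V →L[ℝ] W} (hy : y ≠ 0) (hf : HasFDerivAt f f' y)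
    (hg : HasFDerivAt g g' y) (h : ∀ z ≠ 0, f z = g z) : f' = g' :=
  hf.unique (hg.congr_of_eventuallyEq ((eventually_ne_nhds hy).mono h))

/-- Positive homogeneity of degree `k`. -/
def IsPosHomogeneous (k : ℕ) (f : V → W) : Prop :=
  ∀ t : ℝ, 0 < t → ∀ y, f (t • y) = t ^ k • f y

namespace IsPosHomogeneous

protected theorem map_zero (hf : IsPosHomogeneous (k + 1) f) : f 0 = 0 := by
  have h : (1 - 2 ^ (k + 1) : ℝ) • f 0 = 0 := by
    rw [sub_smul, one_smul, ← hf 2 two_pos 0, smul_zero, sub_self]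
  refine (smul_eq_zero.1 h).resolve_left (sub_ne_zero.2 (ne_of_lt ?_))
  exact one_lt_pow₀ one_lt_two k.succ_ne_zero

protected theorem fderiv_apply_self (hf : IsPosHomogeneous k f) (hd : DifferentiableAt ℝ f y) :
    fderiv ℝ f y y = (k : ℝ) • f y := by
  have hray : HasDerivAt (fun t : ℝ => f (t • y)) (fderiv ℝ f y y) 1 := by
    have hline : HasDerivAt (fun t : ℝ => t • y) y 1 := by
      simpa using (hasDerivAt_id (1 : ℝ)).smul_const y
    refine HasFDerivAt.comp_hasDerivAt (f := fun t : ℝ => t • y) 1 ?_ hline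
    simpa using hd.hasFDerivAt
  have hpow : HasDerivAt (fun t : ℝ => t ^ k • f y) ((k : ℝ) • f y) 1 := by
    simpa using (hasDerivAt_pow k (1 : ℝ)).smul_const (f y)
  refine hray.unique (hpow.congr_of_eventuallyEq ?_)
  filter_upwards [lt_mem_nhds one_pos] with t ht using hf t ht y

protected theorem fderiv (hf : IsPosHomogeneous (k + 1) f) : IsPosHomogeneous k (fderiv ℝ f) := by
  intro t ht y
  have hscale : (fun z => f (t • z)) = fun z => t ^ (k + 1) • f z := funext (hf t ht)
  have h : t • fderiv ℝ f (t • y) = t ^ (k + 1) • fderiv ℝ f y := by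
    rw [← fderiv_comp_smul, hscale]
    exact congrFun (fderiv_const_smul_field (t ^ (k + 1))) y
  rw [pow_succ', mul_smul] at h
  exact smul_right_injective _ ht.ne' h

protected theorem hessian_apply_self (hf : IsPosHomogeneous 2 f) (hd : ContDiffAt ℝ ∞ f y) :
    hessian f y y = fderiv ℝ f y := by
  simpa using hf.fderiv.fderiv_apply_self ((contDiffAt_fderiv hd).differentiableAt (by simp))

end IsPosHomogeneous

end Homogeneous

section Quadratic

variable {V V' W : Type*} [NormedAddCommGroup V] [NormedSpace ℝ V]
  [NormedAddCommGroup V'] [NormedSpace ℝ V'] [NormedAddCommGroup W] [NormedSpace ℝ W]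
  {f g : V → W}

/-- Vector-valued quadratic forms, given by their polar forms. -/
def IsQuadratic (f : V → W) : Prop :=
  ∃ B : V →L[ℝ] V →L[ℝ] W, (∀ u w, B u w = B w u) ∧ ∀ y, f y = B y y

namespace IsQuadratic

protected theorem sub (hf : IsQuadratic f) (hg : IsQuadratic g) :
    IsQuadratic fun y => f y - g y := by
  obtain ⟨B, hB, hfB⟩ := hf
  obtain ⟨C, hC, hgC⟩ := hg
  exact ⟨B - C, fun u w => congrArg₂ (· - ·) (hB u w) (hC u w),
    fun y => congrArg₂ (· - ·) (hfB y) (hgC y)⟩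

protected theorem comp_clm (hf : IsQuadratic f) (L : V' →L[ℝ] V) : IsQuadratic (f ∘ L) := by
  obtain ⟨B, hB, hfB⟩ := hf
  exact ⟨B.bilinearComp L L, fun u w => hB (L u) (L w), fun y => hfB (L y)⟩

theorem clm_smul (a : V →L[ℝ] ℝ) : IsQuadratic fun y => a y • y := by
  refine ⟨(1 / 2 : ℝ) • (a.smulRight (.id ℝ V) + (a.smulRight (.id ℝ V)).flip),
    fun u w => ?_, fun y => ?_⟩
  · simp [add_comm]
  · simp [← add_smul, ← two_mul]

end IsQuadratic

theorem hasFDerivAt_diag {B : V →L[ℝ] V →L[ℝ] W} (hB : ∀ u w, B u w = B w u) (y : V) :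
    HasFDerivAt (fun z => B z z) ((2 : ℝ) • B y) y := by
  refine (B.hasFDerivAt.clm_apply (hasFDerivAt_id y)).congr_fderiv
    (ContinuousLinearMap.ext fun w => ?_)
  simp [hB w y, two_smul]

theorem eq_of_forall_hasFDerivAt_zero (hrank : 1 < Module.rank ℝ V)
    (h : ∀ z ≠ 0, HasFDerivAt f (0 : V →L[ℝ] W) z) {y z : V} (hy : y ≠ 0) (hz : z ≠ 0) :
    f y = f z :=
  isOpen_compl_singleton.is_const_of_fderiv_eq_zero (𝕜 := ℝ)
    (isConnected_compl_singleton_of_one_lt_rank hrank 0).isPreconnected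
    (fun w hw => (h w hw).differentiableAt.differentiableWithinAt) (fun w hw => (h w hw).fderiv)
    hy hz

theorem IsPosHomogeneous.isQuadratic (hf : IsPosHomogeneous 2 f)
    (hsmooth : ∀ y ≠ 0, ContDiffAt ℝ ∞ f y) (hrank : 1 < Module.rank ℝ V)
    (h3 : ∀ y ≠ 0, fderiv ℝ (hessian f) y = 0) : IsQuadratic f := by
  have : Nontrivial V := rank_pos_iff_nontrivial.1 (zero_lt_one.trans hrank)
  obtain ⟨y₀, hy₀⟩ := exists_ne (0 : V)
  have hderiv : ∀ y ≠ 0, HasFDerivAt (hessian f) (0 : V →L[ℝ] V →L[ℝ] V →L[ℝ] W) y :=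
    fun y hy => h3 y hy ▸ ((contDiffAt_fderiv
      (contDiffAt_fderiv (hsmooth y hy))).differentiableAt (by simp)).hasFDerivAt
  have hconst : ∀ y ≠ 0, hessian f y = hessian f y₀ := fun y hy =>
    eq_of_forall_hasFDerivAt_zero hrank hderiv hy hy₀
  refine ⟨(1 / 2 : ℝ) • hessian f y₀,
    fun u w => congrArg _ (hessian_comm (hsmooth y₀ hy₀) u w), fun y => ?_⟩
  rcases eq_or_ne y 0 with rfl | hy
  · simp [hf.map_zero]
  · rw [← hconst y hy]
    simp [hf.hessian_apply_self (hsmooth y hy),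
      hf.fderiv_apply_self ((hsmooth y hy).differentiableAt (by simp)), smul_smul]

end Quadratic

section Minkowski

variable {V V' : Type*} [NormedAddCommGroup V] [NormedSpace ℝ V]
  [NormedAddCommGroup V'] [NormedSpace ℝ V'] {E : V → ℝ} {y : V}

/-- The energy `E = F² / 2` of a Minkowski norm `F`; its Hessian at `y ≠ 0` is the metric `g_y`. -/
structure IsMinkowskiEnergy (E : V → ℝ) : Prop where
  contDiffAt : ∀ y ≠ 0, ContDiffAt ℝ ∞ E y
  homogeneous : IsPosHomogeneous 2 E
  posDef : ∀ y ≠ 0, ∀ w ≠ 0, 0 < hessian E y w w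

namespace IsMinkowskiEnergy

theorem hasFDerivAt (hE : IsMinkowskiEnergy E) (hy : y ≠ 0) : HasFDerivAt E (fderiv ℝ E y) y :=
  ((hE.contDiffAt y hy).differentiableAt (by simp)).hasFDerivAt

theorem hasFDerivAt_fderiv (hE : IsMinkowskiEnergy E) (hy : y ≠ 0) :
    HasFDerivAt (fderiv ℝ E) (hessian E y) y :=
  ((contDiffAt_fderiv (hE.contDiffAt y hy)).differentiableAt (by simp)).hasFDerivAt

theorem contDiffAt_hessian (hE : IsMinkowskiEnergy E) (hy : y ≠ 0) :
    ContDiffAt ℝ ∞ (hessian E) y :=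
  contDiffAt_fderiv (contDiffAt_fderiv (hE.contDiffAt y hy))

theorem hasFDerivAt_hessian (hE : IsMinkowskiEnergy E) (hy : y ≠ 0) :
    HasFDerivAt (hessian E) (fderiv ℝ (hessian E) y) y :=
  ((hE.contDiffAt_hessian hy).differentiableAt (by simp)).hasFDerivAt

protected theorem hessian_comm (hE : IsMinkowskiEnergy E) (hy : y ≠ 0) (u w : V) :
    hessian E y u w = hessian E y w u :=
  Finsler.hessian_comm (hE.contDiffAt y hy) u w

protected theorem hessian_apply_self (hE : IsMinkowskiEnergy E) (hy : y ≠ 0) :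
    hessian E y y = fderiv ℝ E y :=
  hE.homogeneous.hessian_apply_self (hE.contDiffAt y hy)

theorem hessian_apply_apply_self (hE : IsMinkowskiEnergy E) (hy : y ≠ 0) (w : V) :
    hessian E y w y = fderiv ℝ E y w := by
  rw [hE.hessian_comm hy, hE.hessian_apply_self hy]

protected theorem fderiv_apply_self (hE : IsMinkowskiEnergy E) (hy : y ≠ 0) :
    fderiv ℝ E y y = 2 * E y := by
  simpa using hE.homogeneous.fderiv_apply_self ((hE.contDiffAt y hy).differentiableAt (by simp))

theorem pos (hE : IsMinkowskiEnergy E) (hy : y ≠ 0) : 0 < E y := by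
  have h := hE.posDef y hy y hy
  rw [hE.hessian_apply_self hy, hE.fderiv_apply_self hy] at h
  linarith

protected theorem map_zero (hE : IsMinkowskiEnergy E) : E 0 = 0 :=
  hE.homogeneous.map_zero

theorem fderiv_hessian_apply_self (hE : IsMinkowskiEnergy E) (hy : y ≠ 0) :
    fderiv ℝ (hessian E) y y = 0 := by
  simpa using (hE.homogeneous.fderiv.fderiv (k := 0)).fderiv_apply_self
    ((hE.contDiffAt_hessian hy).differentiableAt (by simp))

theorem fderiv_hessian_apply_apply_self (hE : IsMinkowskiEnergy E) (hy : y ≠ 0) (w : V) :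
    fderiv ℝ (hessian E) y w y = 0 := by
  rw [Finsler.hessian_comm (contDiffAt_fderiv (hE.contDiffAt y hy)),
    hE.fderiv_hessian_apply_self hy, zero_apply]

theorem hessian_injective (hE : IsMinkowskiEnergy E) (hy : y ≠ 0) :
    Function.Injective (hessian E y) := by
  refine (injective_iff_map_eq_zero _).2 fun w hw => ?_
  by_contra h0
  simpa [hw] using hE.posDef y hy w h0

theorem comp_equiv (hE : IsMinkowskiEnergy E) (L : V' ≃L[ℝ] V) : IsMinkowskiEnergy (E ∘ L) := by
  have hL : ∀ z ≠ 0, L z ≠ 0 := fun z hz => L.map_eq_zero_iff.not.2 hz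
  refine ⟨fun y hy => (hE.contDiffAt _ (hL y hy)).comp y L.contDiff.contDiffAt,
    fun t ht y => by simp [hE.homogeneous t ht], fun y hy w hw => ?_⟩
  have hd : fderiv ℝ (E ∘ L) = fun z => (fderiv ℝ E (L z)).comp (L : V' →L[ℝ] V) :=
    funext fun z => L.comp_right_fderiv
  have hd2 : HasFDerivAt (fun z => (fderiv ℝ E (L z)).comp (L : V' →L[ℝ] V)) _ y :=
    ((hE.hasFDerivAt_fderiv (hL y hy)).comp y L.hasFDerivAt).clm_comp
      (hasFDerivAt_const (L : V' →L[ℝ] V) y)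
  rw [hessian, hd, hd2.fderiv]
  simpa using hE.posDef _ (hL y hy) _ (hL w hw)

variable [FiniteDimensional ℝ V]

theorem isInvertible_hessian (hE : IsMinkowskiEnergy E) (hy : y ≠ 0) :
    (hessian E y).IsInvertible := by
  have hdual : finrank ℝ V = finrank ℝ (V →L[ℝ] ℝ) :=
    Subspace.dual_finrank_eq.symm.trans
      (LinearMap.toContinuousLinearMap (𝕜 := ℝ) (E := V) (F' := ℝ)).finrank_eq
  exact ⟨(LinearEquiv.ofInjectiveOfFinrankEq (hessian E y : V →ₗ[ℝ] V →L[ℝ] ℝ)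
    (hE.hessian_injective hy) hdual).toContinuousLinearEquiv, rfl⟩

theorem exists_pos_mul_norm_sq_le (hE : IsMinkowskiEnergy E) :
    ∃ c > 0, ∀ y, c * ‖y‖ ^ 2 ≤ E y := by
  have hne : ∀ u ∈ Metric.sphere (0 : V) 1, u ≠ 0 := fun u hu =>
    ne_zero_of_mem_sphere one_ne_zero ⟨u, hu⟩
  obtain ⟨c, hc, hcE⟩ := (isCompact_sphere (0 : V) 1).exists_forall_le'
    (fun u hu => (hE.hasFDerivAt (hne u hu)).continuousAt.continuousWithinAt)
    fun u hu => hE.pos (hne u hu)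
  refine ⟨c, hc, fun y => ?_⟩
  rcases eq_or_ne y 0 with rfl | hy
  · simp [hE.map_zero]
  · have hscale := hE.homogeneous ‖y‖ (norm_pos_iff.2 hy) (‖y‖⁻¹ • y)
    rw [smul_inv_smul₀ (norm_ne_zero_iff.2 hy), smul_eq_mul] at hscale
    rw [hscale, mul_comm]
    gcongr
    exact hcE _ (by simp [norm_smul, hy])

end IsMinkowskiEnergy

section Sharp

/-- The isomorphism from covectors to vectors given by the metric `g_y = hessian E y`; it is `0`
where `g_y` is degenerate. -/
noncomputable def sharp (E : V → ℝ) (y : V) : (V →L[ℝ] ℝ) →L[ℝ] V :=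
  (hessian E y).inverse

namespace IsMinkowskiEnergy

theorem isPosHomogeneous_sharp (hE : IsMinkowskiEnergy E) : IsPosHomogeneous 0 (sharp E) :=
  fun t ht y => by simp [sharp, hE.homogeneous.fderiv.fderiv (k := 0) t ht y]

variable [FiniteDimensional ℝ V]

theorem hessian_sharp (hE : IsMinkowskiEnergy E) (hy : y ≠ 0) (φ : V →L[ℝ] ℝ) :
    hessian E y (sharp E y φ) = φ :=
  (hE.isInvertible_hessian hy).self_apply_inverse φ

theorem sharp_hessian (hE : IsMinkowskiEnergy E) (hy : y ≠ 0) (w : V) :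
    sharp E y (hessian E y w) = w :=
  (hE.isInvertible_hessian hy).inverse_apply_self w

theorem sharp_fderiv (hE : IsMinkowskiEnergy E) (hy : y ≠ 0) :
    sharp E y (fderiv ℝ E y) = y := by
  rw [← hE.hessian_apply_self hy, hE.sharp_hessian hy]

theorem contDiffAt_sharp (hE : IsMinkowskiEnergy E) (hy : y ≠ 0) :
    ContDiffAt ℝ ∞ (sharp E) y :=
  (hE.isInvertible_hessian hy).contDiffAt_map_inverse.comp y (hE.contDiffAt_hessian hy)

end IsMinkowskiEnergy

end Sharp

section TouchingPoint

/-- `y₀` is a point where the hyperplane `a = 1` is tangent to a level set of `E`. -/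
structure IsTouchingPoint (E : V → ℝ) (a : V →L[ℝ] ℝ) (y₀ : V) : Prop where
  apply_eq_one : a y₀ = 1
  fderiv_eq : fderiv ℝ E y₀ = (2 * E y₀) • a

variable {a : V →L[ℝ] ℝ} {y₀ : V}

theorem IsTouchingPoint.ne_zero (h : IsTouchingPoint E a y₀) : y₀ ≠ 0 := by
  rintro rfl
  simpa using h.apply_eq_one

theorem IsMinkowskiEnergy.isTouchingPoint_of_isMinOn (hE : IsMinkowskiEnergy E) (ha : a y₀ = 1)
    (hmin : IsMinOn E {y | a y = 1} y₀) [CompleteSpace V] : IsTouchingPoint E a y₀ := by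
  have hy₀ : y₀ ≠ 0 := by rintro rfl; simp at ha
  have hextr : IsLocalExtrOn E {y | a y = a y₀} y₀ := by
    rw [ha]
    exact Or.inl hmin.localize
  obtain ⟨l, m, hne, hlm⟩ := hextr.exists_multipliers_of_hasStrictFDerivAt_1d
    a.hasStrictFDerivAt ((hE.contDiffAt y₀ hy₀).hasStrictFDerivAt (by simp))
  have hl : l = -m * (2 * E y₀) := by
    have h := DFunLike.congr_fun hlm y₀
    simp only [add_apply, smul_apply, smul_eq_mul, zero_apply, ha, mul_one,
      hE.fderiv_apply_self hy₀] at h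
    linarith
  have hm : m ≠ 0 := by
    rintro rfl
    simp [hl] at hne
  refine ⟨ha, ContinuousLinearMap.ext fun w => mul_left_cancel₀ hm ?_⟩
  have h := DFunLike.congr_fun hlm w
  simp only [hl, add_apply, smul_apply, smul_eq_mul, zero_apply] at h ⊢
  linear_combination h

theorem IsMinkowskiEnergy.exists_isTouchingPoint [FiniteDimensional ℝ V]
    (hE : IsMinkowskiEnergy E) (ha : a ≠ 0) : ∃ y₀, IsTouchingPoint E a y₀ := by
  obtain ⟨v, hv⟩ : ∃ v, a v = 1 :=
    (LinearMap.surjective (f := (a : V →ₗ[ℝ] ℝ)) (by exact_mod_cast ha)) 1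
  have hcont : ContinuousOn E {y | a y = 1} := fun y hy =>
    (hE.hasFDerivAt (y := y) (by rintro rfl; simp at hy)).continuousAt.continuousWithinAt
  have hcoercive : ∀ᶠ y in cocompact V ⊓ 𝓟 {y | a y = 1}, E v ≤ E y := by
    obtain ⟨c, hc, hcE⟩ := hE.exists_pos_mul_norm_sq_le
    have hlim : Tendsto (fun y : V => c * ‖y‖ ^ 2) (cocompact V) atTop :=
      ((tendsto_pow_atTop two_ne_zero).comp tendsto_norm_cocompact_atTop).const_mul_atTop hc
    exact ((hlim.eventually_ge_atTop (E v)).mono fun y hy => hy.trans (hcE y)).filter_mono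
      inf_le_left
  obtain ⟨y₀, hy₀, hmin⟩ := hcont.exists_isMinOn'
    (isClosed_eq a.continuous continuous_const) hv hcoercive
  exact ⟨y₀, hE.isTouchingPoint_of_isMinOn hy₀ hmin⟩

end TouchingPoint

end Minkowski

section PosDefForms

variable {K : Type*} [AddCommGroup K] [Module ℝ K] [FiniteDimensional ℝ K]
  {γ : K →ₗ[ℝ] K →ₗ[ℝ] ℝ}

theorem exists_apply_eq_smul_of_selfAdjoint (hsymm : ∀ u w, γ u w = γ w u)
    (hpos : ∀ w, w ≠ 0 → 0 < γ w w) {T : K →ₗ[ℝ] K} (hT : ∀ u w, γ (T u) w = γ u (T w)) {h : K}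
    (heq : ∀ (l m : ℝ) (e f : K), T e = l • e → T f = m • f → γ h e ≠ 0 → γ h f ≠ 0 → l = m) :
    ∃ l : ℝ, T h = l • h := by
  let core : InnerProductSpace.Core ℝ K :=
    { inner := fun u w => γ u w
      conj_inner_symm := fun u w => hsymm w u
      re_inner_nonneg := fun w => by
        rcases eq_or_ne w 0 with rfl | hw
        · simp
        · exact (hpos w hw).le
      add_left := fun u w z => by simp
      smul_left := fun u w r => by simp
      definite := fun w hw => by_contra fun hne => (hpos w hne).ne' hw }
  let _ : NormedAddCommGroup K := core.toNormedAddCommGroup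
  let _ : InnerProductSpace ℝ K := InnerProductSpace.ofCore core.toCore
  have hS : T.IsSymmetric := hT
  let b := hS.eigenvectorBasis rfl
  have hb : ∀ i, T (b i) = hS.eigenvalues rfl i • b i := hS.apply_eigenvectorBasis rfl
  by_cases hall : ∀ i, γ h (b i) = 0
  · refine ⟨0, ?_⟩
    have h0 : h = 0 := InnerProductSpace.ext_inner_right_basis b.toBasis fun i => by
      change γ h (b.toBasis i) = γ 0 (b.toBasis i)
      rw [OrthonormalBasis.coe_toBasis, hall, map_zero, LinearMap.zero_apply]
    simp [h0]
  · push Not at hall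
    obtain ⟨i, hi⟩ := hall
    refine ⟨hS.eigenvalues rfl i, InnerProductSpace.ext_inner_right_basis b.toBasis fun j => ?_⟩
    change γ (T h) (b.toBasis j) = γ (hS.eigenvalues rfl i • h) (b.toBasis j)
    rw [OrthonormalBasis.coe_toBasis, hT, hb, map_smul, map_smul, LinearMap.smul_apply]
    by_cases hj : γ h (b j) = 0
    · rw [hj, smul_zero, smul_zero]
    · rw [heq _ _ _ _ (hb j) (hb i) hj hi]

theorem exists_orthogonal_of_same_length (hpos : ∀ w, w ≠ 0 → 0 < γ w w)
    (hdim : 2 ≤ finrank ℝ K) (e : K) : ∃ f, γ e f = 0 ∧ γ f f = γ e e := by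
  have hker : LinearMap.ker (γ e) ≠ ⊥ := LinearMap.ker_ne_bot_of_finrank_lt
    (by simpa using one_lt_two.trans_le hdim)
  obtain ⟨f, hf, hf0⟩ := Submodule.exists_mem_ne_zero_of_ne_bot hker
  have hff := hpos f hf0
  have hee : 0 ≤ γ e e := by
    rcases eq_or_ne e 0 with rfl | he
    · simp
    · exact (hpos e he).le
  refine ⟨√(γ e e / γ f f) • f, ?_, ?_⟩
  · rw [map_smul, LinearMap.mem_ker.1 hf, smul_zero]
  · rw [map_smul, map_smul, LinearMap.smul_apply, smul_smul, Real.mul_self_sqrt (by positivity),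
      smul_eq_mul, div_mul_cancel₀ _ hff.ne']

/-- The cubic form `γ (b u u) u` takes equal and opposite values at orthogonal vectors of the same
length. -/
theorem eq_zero_of_forall_apply_self_eq_smul (hsymm : ∀ u w, γ u w = γ w u)
    (hpos : ∀ w, w ≠ 0 → 0 < γ w w) (hdim : 2 ≤ finrank ℝ K) {b : K →ₗ[ℝ] K →ₗ[ℝ] K}
    (hb : ∀ u w, b u w = b w u) (hadj : ∀ u w z, γ (b u w) z = γ w (b u z))
    (heig : ∀ u, ∃ l : ℝ, b u u = l • u) : b = 0 := by
  have hcubic : ∀ e f, γ e f = 0 → γ f f = γ e e → γ (b e e) e = γ (b f f) f := by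
    intro e f hef hlen
    obtain ⟨l, hl⟩ := heig (e + f)
    obtain ⟨le, hle⟩ := heig e
    obtain ⟨lf, hlf⟩ := heig f
    have hfe : γ f e = 0 := (hsymm f e).trans hef
    have hdiag := congrArg (fun z => γ z (e - f)) hl
    have hmixed_e : γ (b e f) e = 0 := by rw [hadj, hle, map_smul, hfe, smul_zero]
    have hmixed_f : γ (b e f) f = 0 := by rw [hb, hadj, hlf, map_smul, hef, smul_zero]
    simp only [map_add, map_sub, map_smul, LinearMap.add_apply, LinearMap.smul_apply, smul_eq_mul,
      hb f e, hmixed_e, hmixed_f, hef, hfe, hlen, hle, hlf] at hdiag ⊢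
    linear_combination hdiag
  have hdiag : ∀ e, b e e = 0 := by
    intro e
    obtain ⟨l, hl⟩ := heig e
    obtain ⟨f, hef, hlen⟩ := exists_orthogonal_of_same_length hpos hdim e
    have hplus := hcubic e f hef hlen
    have hminus := hcubic e (-f) (by simpa using hef) (by simpa using hlen)
    have hzero : γ (b e e) e = 0 := by
      simp only [map_neg, LinearMap.neg_apply, neg_neg] at hminus
      linarith
    rcases eq_or_ne e 0 with rfl | he
    · simp
    · rw [hl, map_smul, LinearMap.smul_apply, smul_eq_mul, mul_eq_zero] at hzero
      rw [hl, hzero.resolve_right (hpos e he).ne', zero_smul]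
  refine LinearMap.ext₂ fun u w => ?_
  have hpolar := hdiag (u + w)
  simp only [map_add, LinearMap.add_apply, hdiag, zero_add, add_zero, hb w u] at hpolar
  rw [← two_smul ℝ] at hpolar
  exact (smul_eq_zero.1 hpolar).resolve_left two_ne_zero

end PosDefForms

section QuadraticGradient

variable {V : Type*} [NormedAddCommGroup V] [NormedSpace ℝ V] {E : V → ℝ} {a : V →L[ℝ] ℝ}
  {B : V →L[ℝ] V →L[ℝ] V} {y y₀ : V}

/-- The vector `2 E(y) • sharp E y a` is the quadratic form `B y y`. -/
structure HasQuadraticGradient (E : V → ℝ) (a : V →L[ℝ] ℝ) (B : V →L[ℝ] V →L[ℝ] V) : Prop where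
  comm : ∀ u w, B u w = B w u
  hessian_apply : ∀ y ≠ 0, hessian E y (B y y) = (2 * E y) • a

theorem IsMinkowskiEnergy.injective_fderiv_line (hE : IsMinkowskiEnergy E) {h v : V} (hv : v ≠ 0)
    (hline : ∀ s : ℝ, h + s • v ≠ 0) :
    Function.Injective fun s : ℝ => fderiv ℝ E (h + s • v) v := by
  have hderiv : ∀ s : ℝ, HasDerivAt (fun s : ℝ => fderiv ℝ E (h + s • v) v)
      (hessian E (h + s • v) v v) s := fun s => by
    have hl : HasDerivAt (fun s : ℝ => h + s • v) v s := by
      simpa using ((hasDerivAt_id s).smul_const v).const_add h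
    simpa [Function.comp_def] using ((hE.hasFDerivAt_fderiv (hline s)).clm_apply
      (hasFDerivAt_const v _)).comp_hasDerivAt s hl
  refine (strictMono_of_deriv_pos fun s => ?_).injective
  rw [(hderiv s).deriv]
  exact hE.posDef _ (hline s) v hv

namespace HasQuadraticGradient

theorem fderiv_apply (hB : HasQuadraticGradient E a B) (hE : IsMinkowskiEnergy E) (hy : y ≠ 0)
    (w : V) : fderiv ℝ E y (B y w) = a y * fderiv ℝ E y w := by
  have hdiag : ∀ z ≠ 0, fderiv ℝ E z (B z z) = 2 * E z * a z := fun z hz => by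
    rw [← hE.hessian_apply_apply_self hz, hB.hessian_apply z hz, smul_apply, smul_eq_mul]
  have hd := DFunLike.congr_fun (fderiv_eq_of_forall_ne_zero hy
    ((hE.hasFDerivAt_fderiv hy).clm_apply (hasFDerivAt_diag hB.comm y))
    (((hE.hasFDerivAt hy).const_mul 2).mul a.hasFDerivAt) hdiag) w
  have hhess : hessian E y w (B y y) = 2 * E y * a w := by
    rw [hE.hessian_comm hy, hB.hessian_apply y hy, smul_apply, smul_eq_mul]
  simp only [add_apply, smul_apply, ContinuousLinearMap.comp_apply,
    ContinuousLinearMap.flip_apply, map_smul, smul_eq_mul, hhess] at hd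
  linear_combination hd / 2

theorem hessian_apply_apply (hB : HasQuadraticGradient E a B) (hE : IsMinkowskiEnergy E)
    (hy : y ≠ 0) (u w : V) :
    hessian E y u (B y w) + fderiv ℝ E y (B u w) =
      a u * fderiv ℝ E y w + a y * hessian E y u w := by
  have hd := DFunLike.congr_fun (fderiv_eq_of_forall_ne_zero hy
    ((hE.hasFDerivAt_fderiv hy).clm_apply (B.hasFDerivAt.clm_apply (hasFDerivAt_const w y)))
    (a.hasFDerivAt.mul ((hE.hasFDerivAt_fderiv hy).clm_apply (hasFDerivAt_const w y)))
    fun z hz => hB.fderiv_apply hE hz w) u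
  simp only [add_apply, smul_apply, ContinuousLinearMap.comp_apply,
    ContinuousLinearMap.flip_apply, zero_apply, map_zero, zero_add, smul_eq_mul] at hd
  linear_combination hd

theorem apply_touchingPoint (hB : HasQuadraticGradient E a B) (hE : IsMinkowskiEnergy E)
    (h₀ : IsTouchingPoint E a y₀) (w : V) : B y₀ w = a w • y₀ := by
  have hy₀ := h₀.ne_zero
  have hself : B y₀ y₀ = y₀ := hE.hessian_injective hy₀ <| by
    rw [hB.hessian_apply y₀ hy₀, hE.hessian_apply_self hy₀, h₀.fderiv_eq]
  have hd := DFunLike.congr_fun (fderiv_eq_of_forall_ne_zero hy₀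
    ((hE.hasFDerivAt_hessian hy₀).clm_apply (hasFDerivAt_diag hB.comm y₀))
    (((hE.hasFDerivAt hy₀).const_mul 2).smul_const a) hB.hessian_apply) w
  have hhess : (2 : ℝ) • hessian E y₀ (B y₀ w) = (2 * fderiv ℝ E y₀ w) • a := by
    simpa [hself, hE.fderiv_hessian_apply_apply_self hy₀] using hd
  refine hE.hessian_injective hy₀ ?_
  rw [map_smul, hE.hessian_apply_self hy₀]
  rw [mul_smul] at hhess
  rw [smul_right_injective _ two_ne_zero hhess, h₀.fderiv_eq, smul_apply, smul_eq_mul, smul_smul,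
    mul_comm]

theorem mul_apply_eq_hessian (hB : HasQuadraticGradient E a B) (hE : IsMinkowskiEnergy E)
    (h₀ : IsTouchingPoint E a y₀) (u w : V) :
    2 * E y₀ * a (B u w) = hessian E y₀ u w := by
  have h := hB.hessian_apply_apply hE h₀.ne_zero u w
  rw [hB.apply_touchingPoint hE h₀, map_smul, hE.hessian_apply_apply_self h₀.ne_zero,
    h₀.fderiv_eq, h₀.apply_eq_one] at h
  simp only [smul_apply, smul_eq_mul] at h
  linear_combination h

theorem hessian_apply_comm (hB : HasQuadraticGradient E a B) (hE : IsMinkowskiEnergy E)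
    (h₀ : IsTouchingPoint E a y₀) (u : V) {w z : V} (hw : a w = 0) (hz : a z = 0) :
    hessian E y₀ z (B u w) = hessian E y₀ w (B u z) := by
  have hd : ∀ v w, HasFDerivAt (fun y => hessian E y v (B y w)) _ y₀ := fun v w =>
    ((hE.hasFDerivAt_hessian h₀.ne_zero).clm_apply (hasFDerivAt_const v y₀)).clm_apply
      (B.hasFDerivAt.clm_apply (hasFDerivAt_const w y₀))
  have hsymm : ∀ y ≠ 0, hessian E y z (B y w) = hessian E y w (B y z) := by
    intro y hy
    have hzw := hB.hessian_apply_apply hE hy z w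
    have hwz := hB.hessian_apply_apply hE hy w z
    rw [hz, zero_mul] at hzw
    rw [hw, zero_mul, hB.comm w z, hE.hessian_comm hy w z] at hwz
    linear_combination hzw - hwz
  have h := DFunLike.congr_fun (fderiv_eq_of_forall_ne_zero h₀.ne_zero (hd z w) (hd w z) hsymm) u
  simpa [hB.apply_touchingPoint hE h₀, hw, hz] using h

theorem fderiv_eigenvalue (hB : HasQuadraticGradient E a B) (hE : IsMinkowskiEnergy E)
    (h₀ : IsTouchingPoint E a y₀) {h e : V} {l : ℝ} (he : a e = 0) (hne : h + l • y₀ ≠ 0)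
    (hh : a h = 0) (hl : B h e - a (B h e) • y₀ = l • e) (hhe : hessian E y₀ h e ≠ 0) :
    fderiv ℝ E (h + l • y₀) y₀ = 0 := by
  have hBe : B (h + l • y₀) e = l • e + a (B h e) • y₀ := by
    rw [map_add, map_smul, add_apply, smul_apply, hB.apply_touchingPoint hE h₀, he, zero_smul,
      smul_zero, add_zero, ← hl, sub_add_cancel]
  have hgrad := hB.fderiv_apply hE hne e
  rw [hBe] at hgrad
  simp only [map_add, map_smul, smul_eq_mul, hh, h₀.apply_eq_one] at hgrad
  have hnormal : a (B h e) ≠ 0 := fun h0 => hhe <| by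
    rw [← hB.mul_apply_eq_hessian hE h₀, h0, mul_zero]
  refine (mul_eq_zero.1 ?_).resolve_left hnormal
  linear_combination hgrad

theorem eigenvalue_unique (hB : HasQuadraticGradient E a B) (hE : IsMinkowskiEnergy E)
    (h₀ : IsTouchingPoint E a y₀) {h e f : V} {l m : ℝ} (hh : a h = 0) (he : a e = 0)
    (hf : a f = 0) (hl : B h e - a (B h e) • y₀ = l • e) (hm : B h f - a (B h f) • y₀ = m • f)
    (hhe : hessian E y₀ h e ≠ 0) (hhf : hessian E y₀ h f ≠ 0) : l = m := by
  have hline : ∀ s : ℝ, h + s • y₀ ≠ 0 := by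
    intro s hs
    have hs0 : s = 0 := by simpa [hh, h₀.apply_eq_one] using congrArg a hs
    rw [hs0, zero_smul, add_zero] at hs
    simp [hs] at hhe
  refine hE.injective_fderiv_line h₀.ne_zero hline ?_
  exact (hB.fderiv_eigenvalue hE h₀ he (hline l) hh hl hhe).trans
    (hB.fderiv_eigenvalue hE h₀ hf (hline m) hh hm hhf).symm

end HasQuadraticGradient

/-- The component along `ker a` of `B`, restricted to `ker a`; the complement of `ker a` is spanned
by the touching point. -/
noncomputable def IsTouchingPoint.tangentialPart (h₀ : IsTouchingPoint E a y₀)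
    (B : V →L[ℝ] V →L[ℝ] V) :
    LinearMap.ker (a : V →ₗ[ℝ] ℝ) →ₗ[ℝ] LinearMap.ker (a : V →ₗ[ℝ] ℝ) →ₗ[ℝ]
      LinearMap.ker (a : V →ₗ[ℝ] ℝ) :=
  (B.toLinearMap₁₂.domRestrict₁₂ _ _).compr₂
    (a.projKerOfRightInverse (.toSpanSingleton ℝ y₀) fun t => by simp [h₀.apply_eq_one])

theorem IsTouchingPoint.coe_tangentialPart (h₀ : IsTouchingPoint E a y₀)
    (B : V →L[ℝ] V →L[ℝ] V) (h w : LinearMap.ker (a : V →ₗ[ℝ] ℝ)) :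
    (h₀.tangentialPart B h w : V) = B h w - a (B h w) • y₀ := by
  rfl

namespace HasQuadraticGradient

theorem tangentialPart_eq_zero [FiniteDimensional ℝ V] (hB : HasQuadraticGradient E a B)
    (hE : IsMinkowskiEnergy E) (h₀ : IsTouchingPoint E a y₀) (hdim : 3 ≤ finrank ℝ V) :
    h₀.tangentialPart B = 0 := by
  have ha : (a : V →ₗ[ℝ] ℝ) ≠ 0 := fun h0 => by
    simpa [h₀.apply_eq_one] using DFunLike.congr_fun h0 y₀
  have hker : 2 ≤ finrank ℝ (LinearMap.ker (a : V →ₗ[ℝ] ℝ)) := by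
    have := Module.Dual.finrank_ker_add_one_of_ne_zero ha
    lia
  let γ := (hessian E y₀).toLinearMap₁₂.domRestrict₁₂ (LinearMap.ker (a : V →ₗ[ℝ] ℝ))
    (LinearMap.ker (a : V →ₗ[ℝ] ℝ))
  have hsymm : ∀ u w, γ u w = γ w u := fun u w => hE.hessian_comm h₀.ne_zero u w
  have hpos : ∀ w, w ≠ 0 → 0 < γ w w := fun w hw =>
    hE.posDef y₀ h₀.ne_zero w (Submodule.coe_eq_zero.not.2 hw)
  have hnormal : ∀ w : LinearMap.ker (a : V →ₗ[ℝ] ℝ), hessian E y₀ w y₀ = 0 := fun w => by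
    rw [hE.hessian_apply_apply_self h₀.ne_zero, h₀.fderiv_eq, smul_apply,
      show a w = 0 from w.2, smul_zero]
  have hγ : ∀ u w z, γ z (h₀.tangentialPart B u w) = hessian E y₀ z (B u w) := fun u w z => by
    change hessian E y₀ z (h₀.tangentialPart B u w : V) = _
    rw [h₀.coe_tangentialPart, map_sub, map_smul, hnormal, smul_zero, sub_zero]
  have hadj : ∀ u w z, γ (h₀.tangentialPart B u w) z = γ w (h₀.tangentialPart B u z) :=
    fun u w z => by
      rw [hsymm, hγ, hγ, hB.hessian_apply_comm hE h₀ u w.2 z.2]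
  refine eq_zero_of_forall_apply_self_eq_smul hsymm hpos hker
    (fun u w => Subtype.ext (by simp only [h₀.coe_tangentialPart, hB.comm u w])) hadj fun h => ?_
  refine exists_apply_eq_smul_of_selfAdjoint hsymm hpos (hadj h) fun l m e f hl hm hhe hhf => ?_
  refine hB.eigenvalue_unique hE h₀ h.2 e.2 f.2 ?_ ?_ hhe hhf
  · rw [← h₀.coe_tangentialPart, hl, Submodule.coe_smul]
  · rw [← h₀.coe_tangentialPart, hm, Submodule.coe_smul]

theorem smul_apply_eq (hB : HasQuadraticGradient E a B) (hE : IsMinkowskiEnergy E)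
    (h₀ : IsTouchingPoint E a y₀) (htan : h₀.tangentialPart B = 0) (u w : V) :
    (2 * E y₀) • B u w = hessian E y₀ u w • y₀ := by
  let proj : V → LinearMap.ker (a : V →ₗ[ℝ] ℝ) := fun v =>
    ⟨v - a v • y₀, by simp [h₀.apply_eq_one]⟩
  have hproj : B (proj u) (proj w) = B u w - (a u * a w) • y₀ := by
    simp only [proj, map_sub, map_smul, sub_apply, smul_apply, hB.apply_touchingPoint hE h₀,
      hB.comm u y₀, h₀.apply_eq_one]
    module
  have hnormal : B u w = a (B u w) • y₀ := by
    have h := h₀.coe_tangentialPart B (proj u) (proj w)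
    rw [htan, hproj] at h
    simp only [LinearMap.zero_apply, Submodule.coe_zero, map_sub, map_smul, h₀.apply_eq_one,
      smul_eq_mul, mul_one, sub_smul] at h
    rw [sub_sub_sub_cancel_right] at h
    exact sub_eq_zero.1 h.symm
  rw [hnormal, smul_smul, hB.mul_apply_eq_hessian hE h₀]

theorem hessian_mul_fderiv_apply (hB : HasQuadraticGradient E a B) (hE : IsMinkowskiEnergy E)
    (h₀ : IsTouchingPoint E a y₀) (htan : h₀.tangentialPart B = 0) (hy : y ≠ 0) (w : V) :
    hessian E y₀ y w * fderiv ℝ E y y₀ = 2 * E y₀ * (a y * fderiv ℝ E y w) := by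
  rw [← hB.fderiv_apply hE hy, ← smul_eq_mul, ← map_smul, ← hB.smul_apply_eq hE h₀ htan, map_smul,
    smul_eq_mul]

theorem hessian_mul_hessian_apply (hB : HasQuadraticGradient E a B) (hE : IsMinkowskiEnergy E)
    (h₀ : IsTouchingPoint E a y₀) (htan : h₀.tangentialPart B = 0) (hy : y ≠ 0) (w : V) :
    hessian E y₀ y y * hessian E y y₀ w = 2 * E y₀ * (2 * E y * a w) := by
  have h := DFunLike.congr_fun (hB.hessian_apply y hy) w
  rw [smul_apply, smul_eq_mul] at h
  rw [← h, ← smul_eq_mul, ← smul_apply, ← map_smul, ← hB.smul_apply_eq hE h₀ htan, map_smul,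
    smul_apply, smul_eq_mul]

theorem hessian_mul_fderiv (hB : HasQuadraticGradient E a B) (hE : IsMinkowskiEnergy E)
    (h₀ : IsTouchingPoint E a y₀) (htan : h₀.tangentialPart B = 0) (hy : y ≠ 0) (w : V) :
    hessian E y₀ y y * fderiv ℝ E y w = 2 * E y * hessian E y₀ y w := by
  have hd := DFunLike.congr_fun (fderiv_eq_of_forall_ne_zero hy
    ((((hessian E y₀).hasFDerivAt).clm_apply (hasFDerivAt_const w y)).mul
      ((hE.hasFDerivAt_fderiv hy).clm_apply (hasFDerivAt_const y₀ y)))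
    ((a.hasFDerivAt.mul ((hE.hasFDerivAt_fderiv hy).clm_apply (hasFDerivAt_const w y))).const_mul
      (2 * E y₀)) fun z hz => hB.hessian_mul_fderiv_apply hE h₀ htan hz w) y₀
  have hy₀w : hessian E y₀ y₀ w = 2 * E y₀ * a w := by
    rw [hE.hessian_apply_self h₀.ne_zero, h₀.fderiv_eq, smul_apply, smul_eq_mul]
  simp only [add_apply, smul_apply, ContinuousLinearMap.comp_apply, ContinuousLinearMap.flip_apply,
    zero_apply, map_zero, zero_add, smul_eq_mul, hy₀w, h₀.apply_eq_one] at hd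
  have hQ := hB.hessian_mul_hessian_apply hE h₀ htan hy
  have hQy := hQ y
  have hQy₀ := hQ y₀
  rw [hE.hessian_apply_apply_self hy] at hQy
  rw [h₀.apply_eq_one] at hQy₀
  have hm : 2 * E y₀ ≠ 0 := mul_ne_zero two_ne_zero (hE.pos h₀.ne_zero).ne'
  apply mul_left_cancel₀ hm
  linear_combination (-hessian E y₀ y y) * hd + hessian E y₀ y w * hQy₀ - 2 * E y₀ * a y * hQ w +
    2 * E y₀ * a w * hQy

theorem isQuadratic [FiniteDimensional ℝ V] (hB : HasQuadraticGradient E a B)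
    (hE : IsMinkowskiEnergy E) (ha : a ≠ 0) (hdim : 3 ≤ finrank ℝ V) : IsQuadratic E := by
  obtain ⟨y₀, h₀⟩ := hE.exists_isTouchingPoint ha
  have htan := hB.tangentialPart_eq_zero hE h₀ hdim
  have hQpos : ∀ y ≠ 0, 0 < hessian E y₀ y y := hE.posDef y₀ h₀.ne_zero
  have hratio : ∀ y ≠ 0, HasFDerivAt (fun z => E z * (hessian E y₀ z z)⁻¹) (0 : V →L[ℝ] ℝ) y := by
    intro y hy
    have hinv := HasDerivAt.comp_hasFDerivAt (f := fun z => hessian E y₀ z z) y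
      (hasDerivAt_inv (hQpos y hy).ne') (hasFDerivAt_diag (hE.hessian_comm h₀.ne_zero) y)
    refine ((hE.hasFDerivAt hy).mul hinv).congr_fderiv ?_
    ext w
    have hlog := hB.hessian_mul_fderiv hE h₀ htan hy w
    have hne := (hQpos y hy).ne'
    simp only [add_apply, smul_apply, smul_eq_mul, zero_apply, Function.comp_apply]
    field_simp
    linear_combination hlog
  have hconst : ∀ y ≠ 0, E y / hessian E y₀ y y = E y₀ / hessian E y₀ y₀ y₀ := by
    intro y hy
    simpa only [div_eq_mul_inv] using
      eq_of_forall_hasFDerivAt_zero (lt_rank_of_lt_finrank (by lia)) hratio hy h₀.ne_zero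
  refine ⟨(1 / 2 : ℝ) • hessian E y₀, fun u w => congrArg _ (hE.hessian_comm h₀.ne_zero u w),
    fun y => ?_⟩
  rcases eq_or_ne y 0 with rfl | hy
  · simp [hE.map_zero]
  · have h := hconst y hy
    rw [hE.hessian_apply_self h₀.ne_zero, hE.fderiv_apply_self h₀.ne_zero,
      div_eq_div_iff (hQpos y hy).ne' (mul_pos two_pos (hE.pos h₀.ne_zero)).ne'] at h
    apply mul_left_cancel₀ (hE.pos h₀.ne_zero).ne'
    simp only [smul_apply, smul_eq_mul]
    linear_combination h / 2

end HasQuadraticGradient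

theorem IsMinkowskiEnergy.isQuadratic_of_isQuadratic_smul_sharp [FiniteDimensional ℝ V]
    (hE : IsMinkowskiEnergy E) (hdim : 3 ≤ finrank ℝ V) (ha : a ≠ 0)
    (hgrad : IsQuadratic fun y => E y • sharp E y a) : IsQuadratic E := by
  obtain ⟨B, hB, hgradB⟩ := hgrad
  refine HasQuadraticGradient.isQuadratic (B := (2 : ℝ) • B)
    ⟨fun u w => congrArg _ (hB u w), fun y hy => ?_⟩ hE ha hdim
  rw [smul_apply, smul_apply, ← hgradB, smul_smul, map_smul, hE.hessian_sharp hy]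

end QuadraticGradient


section Spray

variable {V W : Type*} [NormedAddCommGroup V] [NormedSpace ℝ V]
  [NormedAddCommGroup W] [NormedSpace ℝ W] {E : V → V → ℝ} {β : V → ℝ} {x y : V}

theorem fderiv_eq_add_of_forall_ne_zero {f g h : V → W} (hf : ∀ z ≠ 0, ContDiffAt ℝ ∞ f z)
    (hg : ∀ z ≠ 0, ContDiffAt ℝ ∞ g z) (hadd : ∀ z ≠ 0, h z = f z + g z) :
    ∀ z ≠ 0, fderiv ℝ h z = fderiv ℝ f z + fderiv ℝ g z := fun z hz => by
  have heq : h =ᶠ[𝓝 z] f + g := (eventually_ne_nhds hz).mono hadd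
  rw [heq.fderiv_eq, fderiv_add ((hf z hz).differentiableAt (by simp))
    ((hg z hz).differentiableAt (by simp))]

theorem hessian_const_mul (c : ℝ) (f : V → ℝ) (y : V) :
    hessian (fun z => c * f z) y = c • hessian f y := by
  have h : fderiv ℝ (fun z => c * f z) = c • fderiv ℝ f := fderiv_const_smul_field c
  rw [hessian, h]
  exact congrFun (fderiv_const_smul_field (f := fderiv ℝ f) c) y

namespace IsMinkowskiEnergy

variable {f : V → ℝ} {c : ℝ}

theorem const_mul (hf : IsMinkowskiEnergy f) (hc : 0 < c) :
    IsMinkowskiEnergy fun y => c * f y where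
  contDiffAt y hy := contDiffAt_const.mul (hf.contDiffAt y hy)
  homogeneous t ht y := by
    simp only [hf.homogeneous t ht y, smul_eq_mul, mul_left_comm]
  posDef y hy w hw := by
    rw [hessian_const_mul]
    exact mul_pos hc (hf.posDef y hy w hw)

theorem sharp_const_mul [FiniteDimensional ℝ V] (hf : IsMinkowskiEnergy f) (hc : 0 < c)
    (hy : y ≠ 0) : sharp (fun z => c * f z) y = c⁻¹ • sharp f y := by
  ext1 φ
  have hφ : hessian (fun z => c * f z) y (c⁻¹ • sharp f y φ) = φ := by
    rw [hessian_const_mul, map_smul, smul_apply, inv_smul_smul₀ hc.ne', hf.hessian_sharp hy]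
  rw [smul_apply, ← (hf.const_mul hc).sharp_hessian hy (c⁻¹ • sharp f y φ), hφ]

end IsMinkowskiEnergy

/-- The derivative of the energy in the position, at a fixed vector. -/
noncomputable def baseDeriv (E : V → V → ℝ) (x y : V) : V →L[ℝ] ℝ :=
  fderiv ℝ (fun x' => E x' y) x

/-- The geodesic spray of the energy `E`, in coordinates: the vector with components `spray E l`. -/
noncomputable def sprayVector (E : V → V → ℝ) (x y : V) : V :=
  (1 / 2 : ℝ) • sharp (E x) y ((fderiv ℝ (baseDeriv E x) y).flip y - baseDeriv E x y)

/-- `E x` is the energy of a Minkowski norm, and `E` has the regularity in `x` that makes its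
geodesic spray at `x` smooth. -/
structure IsFinslerEnergyAt (E : V → V → ℝ) (x : V) : Prop where
  isMinkowskiEnergy : IsMinkowskiEnergy (E x)
  differentiableAt : ∀ y ≠ 0, DifferentiableAt ℝ (fun x' => E x' y) x
  contDiffAt_baseDeriv : ∀ y ≠ 0, ContDiffAt ℝ ∞ (baseDeriv E x) y

theorem isFinslerEnergyAt_of_contDiffAt (hE : IsMinkowskiEnergy (E x))
    (hsmooth : ∀ y ≠ 0, ContDiffAt ℝ ∞ (fun p : V × V => E p.1 p.2) (x, y)) :
    IsFinslerEnergyAt E x where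
  isMinkowskiEnergy := hE
  differentiableAt y hy :=
    ((hsmooth y hy).comp x (f := fun x' => (x', y)) (by fun_prop)).differentiableAt (by simp)
  contDiffAt_baseDeriv y hy :=
    ContDiffAt.fderiv (f := fun y x' => E x' y) (g := fun _ => x) (n := ∞)
      ((hsmooth y hy).comp (y, x) (f := Prod.swap)
        (contDiff_snd.prodMk contDiff_fst).contDiffAt) contDiffAt_const
      (by simp)

/-- The energy of `e^β F`, where `E` is the energy of `F`. -/
noncomputable def conformalEnergy (β : V → ℝ) (E : V → V → ℝ) (x y : V) : ℝ :=
  Real.exp (β x) ^ 2 * E x y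

namespace IsFinslerEnergyAt

theorem baseDeriv_conformalEnergy (hE : IsFinslerEnergyAt E x) (hβ : DifferentiableAt ℝ β x)
    (hy : y ≠ 0) :
    baseDeriv (conformalEnergy β E) x y =
      Real.exp (β x) ^ 2 • ((2 * E x y) • fderiv ℝ β x + baseDeriv E x y) := by
  refine ((hβ.hasFDerivAt.exp.pow 2).mul (hE.differentiableAt y hy).hasFDerivAt).fderiv.trans ?_
  ext w
  simp [baseDeriv]
  ring

theorem contDiffAt_sprayVector [FiniteDimensional ℝ V] (hE : IsFinslerEnergyAt E x) (hy : y ≠ 0) :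
    ContDiffAt ℝ ∞ (sprayVector E x) y := by
  have hbase := hE.contDiffAt_baseDeriv y hy
  have heval : ContDiff ℝ ∞ (ContinuousLinearMap.apply ℝ ℝ : V →L[ℝ] (V →L[ℝ] ℝ) →L[ℝ] ℝ) :=
    ContinuousLinearMap.contDiff _
  have hflip : ContDiffAt ℝ ∞ (fun z => (fderiv ℝ (baseDeriv E x) z).flip z) y :=
    heval.contDiffAt.clm_comp (contDiffAt_fderiv hbase)
  exact ((hE.isMinkowskiEnergy.contDiffAt_sharp hy).clm_apply
    (hflip.sub hbase)).const_smul _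

theorem conformalEnergy (hE : IsFinslerEnergyAt E x) (hβ : DifferentiableAt ℝ β x) :
    IsFinslerEnergyAt (conformalEnergy β E) x where
  isMinkowskiEnergy := hE.isMinkowskiEnergy.const_mul (by positivity)
  differentiableAt y hy := (hβ.exp.pow 2).mul (hE.differentiableAt y hy)
  contDiffAt_baseDeriv y hy :=
    ((((contDiffAt_const.mul (hE.isMinkowskiEnergy.contDiffAt y hy)).smul
      contDiffAt_const).add (hE.contDiffAt_baseDeriv y hy)).const_smul _).congr_of_eventuallyEq <|
        (eventually_ne_nhds hy).mono fun _ hz => hE.baseDeriv_conformalEnergy hβ hz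

theorem sprayVector_conformalEnergy [FiniteDimensional ℝ V] (hE : IsFinslerEnergyAt E x)
    (hβ : DifferentiableAt ℝ β x) (hy : y ≠ 0) :
    sprayVector (Finsler.conformalEnergy β E) x y =
      sprayVector E x y + (fderiv ℝ β x y • y - E x y • sharp (E x) y (fderiv ℝ β x)) := by
  have hc : Real.exp (β x) ^ 2 ≠ 0 := by positivity
  have hfderiv := fderiv_eq_of_forall_ne_zero hy
    (((hE.conformalEnergy hβ).contDiffAt_baseDeriv y hy).differentiableAt (by simp)).hasFDerivAt
    (((((hE.isMinkowskiEnergy.hasFDerivAt hy).const_mul 2).smul_const (fderiv ℝ β x)).add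
      ((hE.contDiffAt_baseDeriv y hy).differentiableAt (by simp)).hasFDerivAt).const_smul
        (Real.exp (β x) ^ 2)) fun _ hz => hE.baseDeriv_conformalEnergy hβ hz
  have hflip : (fderiv ℝ (baseDeriv (Finsler.conformalEnergy β E) x) y).flip y =
      Real.exp (β x) ^ 2 • ((2 * fderiv ℝ β x y) • fderiv ℝ (E x) y +
        (fderiv ℝ (baseDeriv E x) y).flip y) := by
    rw [hfderiv]
    ext w
    simp
    ring
  have hsharp : sharp (Finsler.conformalEnergy β E x) y =
      (Real.exp (β x) ^ 2)⁻¹ • sharp (E x) y :=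
    hE.isMinkowskiEnergy.sharp_const_mul (by positivity) hy
  rw [sprayVector, sprayVector, hflip, hE.baseDeriv_conformalEnergy hβ hy, hsharp, ← smul_sub,
    smul_apply, map_smul, inv_smul_smul₀ hc]
  simp only [map_sub, map_add, map_smul, hE.isMinkowskiEnergy.sharp_fderiv hy]
  module

theorem isQuadratic_of_fderiv_hessian_sprayVector_eq [FiniteDimensional ℝ V]
    (hE : IsFinslerEnergyAt E x) (hdim : 3 ≤ finrank ℝ V) (hβ : fderiv ℝ β x ≠ 0)
    (h : ∀ y ≠ 0, fderiv ℝ (hessian (sprayVector (Finsler.conformalEnergy β E) x)) y =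
      fderiv ℝ (hessian (sprayVector E x)) y) :
    IsQuadratic (E x) := by
  have hβd : DifferentiableAt ℝ β x := by_contra fun h0 =>
    hβ (fderiv_zero_of_not_differentiableAt h0)
  have hM := hE.isMinkowskiEnergy
  let a := fderiv ℝ β x
  let Q : V → V := fun y => a y • y - E x y • sharp (E x) y a
  have hQsmooth : ∀ y ≠ 0, ContDiffAt ℝ ∞ Q y := fun y hy =>
    (a.contDiff.contDiffAt.smul contDiffAt_id).sub
      ((hM.contDiffAt y hy).smul ((hM.contDiffAt_sharp hy).clm_apply contDiffAt_const))
  have hQhom : IsPosHomogeneous 2 Q := fun t ht y => by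
    simp only [Q, hM.homogeneous t ht, hM.isPosHomogeneous_sharp t ht, map_smul, pow_zero, one_smul,
      smul_eq_mul]
    module
  have hS : ∀ z ≠ 0, ContDiffAt ℝ ∞ (sprayVector E x) z := fun z hz => hE.contDiffAt_sprayVector hz
  have hQ3 : ∀ y ≠ 0, fderiv ℝ (hessian Q) y = 0 := fun y hy => by
    have h1 := fderiv_eq_add_of_forall_ne_zero hS hQsmooth
      fun z hz => hE.sprayVector_conformalEnergy hβd hz
    have h2 := fderiv_eq_add_of_forall_ne_zero (fun z hz => contDiffAt_fderiv (hS z hz))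
      (fun z hz => contDiffAt_fderiv (hQsmooth z hz)) h1
    have h3 := fderiv_eq_add_of_forall_ne_zero
      (fun z hz => contDiffAt_fderiv (contDiffAt_fderiv (hS z hz)))
      (fun z hz => contDiffAt_fderiv (contDiffAt_fderiv (hQsmooth z hz))) h2 y hy
    rwa [h y hy, left_eq_add] at h3
  have hQ : IsQuadratic Q := hQhom.isQuadratic hQsmooth (lt_rank_of_lt_finrank (by lia)) hQ3
  refine hM.isQuadratic_of_isQuadratic_smul_sharp hdim hβ ?_
  simpa only [Q, sub_sub_cancel] using (IsQuadratic.clm_smul a).sub hQ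

end IsFinslerEnergyAt

end Spray

section Coordinates

variable {n : ℕ} {W : Type*} [NormedAddCommGroup W] [NormedSpace ℝ W]
  {E : Vec n → Vec n → ℝ} {x y : Vec n}

theorem eq_sum_smul_proj (φ : Vec n →L[ℝ] ℝ) :
    φ = ∑ i, φ (EuclideanSpace.single i 1) • EuclideanSpace.proj i := by
  ext w
  conv_lhs => rw [← (EuclideanSpace.basisFun (Fin n) ℝ).sum_repr w]
  simp [mul_comm]

theorem ext_single {φ ψ : Vec n →L[ℝ] W}
    (h : ∀ i, φ (EuclideanSpace.single i 1) = ψ (EuclideanSpace.single i 1)) : φ = ψ :=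
  ContinuousLinearMap.coe_injective <|
    (EuclideanSpace.basisFun (Fin n) ℝ).toBasis.ext fun i => by simpa using h i

theorem pd_eq_of_eq_clm {f : Vec n → ℝ} {Z : Vec n → W} (φ : W →L[ℝ] ℝ)
    (hZ : ∀ z ≠ 0, ContDiffAt ℝ ∞ Z z) (h : ∀ z ≠ 0, f z = φ (Z z)) (i : Fin n) :
    ∀ z ≠ 0, pd i f z =
      (φ ∘L ContinuousLinearMap.apply ℝ W (EuclideanSpace.single i 1)) (fderiv ℝ Z z) := by
  intro z hz
  have hd := ((hZ z hz).differentiableAt (by simp)).hasFDerivAt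
  rw [pd, ((φ.hasFDerivAt.comp z hd).congr_of_eventuallyEq
    ((eventually_ne_nhds hz).mono h)).fderiv]
  rfl

theorem pd_clm_apply {Z : Vec n → W →L[ℝ] ℝ} (hZ : DifferentiableAt ℝ Z y) (w : W) (i : Fin n) :
    pd i (fun z => Z z w) y = fderiv ℝ Z y (EuclideanSpace.single i 1) w := by
  rw [pd, fderiv_clm_apply hZ (differentiableAt_const w)]
  simp

theorem gCoord_eq_hessian (hE : IsMinkowskiEnergy (E x)) (hy : y ≠ 0) (i j : Fin n) :
    gCoord E x y i j =
      hessian (E x) y (EuclideanSpace.single j 1) (EuclideanSpace.single i 1) :=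
  pd_clm_apply ((contDiffAt_fderiv (hE.contDiffAt y hy)).differentiableAt (by simp)) _ j

theorem inv_gCoord (hE : IsMinkowskiEnergy (E x)) (hy : y ≠ 0) :
    (gCoord E x y)⁻¹ = Matrix.of fun l m => sharp (E x) y (EuclideanSpace.proj m) l := by
  refine Matrix.inv_eq_left_inv (Matrix.ext fun l j => ?_)
  have h := congrArg (fun φ => sharp (E x) y φ l)
    (eq_sum_smul_proj (hessian (E x) y (EuclideanSpace.single j 1)))
  simp only [hE.sharp_hessian hy, map_sum, map_smul, WithLp.ofLp_sum, Finset.sum_apply,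
    PiLp.smul_apply, smul_eq_mul, ← gCoord_eq_hessian hE hy] at h
  simp only [Matrix.mul_apply, Matrix.of_apply, Matrix.one_apply, mul_comm, ← h]
  simp

theorem sum_inv_gCoord_mul (hE : IsMinkowskiEnergy (E x)) (hy : y ≠ 0) (φ : Vec n →L[ℝ] ℝ)
    (l : Fin n) :
    ∑ m, (gCoord E x y)⁻¹ l m * φ (EuclideanSpace.single m 1) = sharp (E x) y φ l := by
  conv_rhs => rw [eq_sum_smul_proj φ]
  simp [inv_gCoord hE hy, mul_comm]

namespace IsFinslerEnergyAt

theorem spray_eq_sprayVector (hE : IsFinslerEnergyAt E x) (hy : y ≠ 0) (l : Fin n) :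
    spray E l x y = sprayVector E x y l := by
  have hterm : ∀ m, (∑ k, y k * pd m (fun y' => pd k (fun x' => E x' y') x) y) -
      pd m (fun x' => E x' y) x =
        ((fderiv ℝ (baseDeriv E x) y).flip y - baseDeriv E x y) (EuclideanSpace.single m 1) := by
    intro m
    have hpd : ∀ k, pd m (fun y' => pd k (fun x' => E x' y') x) y =
        fderiv ℝ (baseDeriv E x) y (EuclideanSpace.single m 1) (EuclideanSpace.single k 1) :=
      fun k => pd_clm_apply ((hE.contDiffAt_baseDeriv y hy).differentiableAt (by simp)) _ m
    rw [sub_apply, ContinuousLinearMap.flip_apply,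
      eq_sum_smul_proj (fderiv ℝ (baseDeriv E x) y (EuclideanSpace.single m 1))]
    have hbase : pd m (fun x' => E x' y) x = baseDeriv E x y (EuclideanSpace.single m 1) := rfl
    simp [hpd, hbase, mul_comm]
  simp only [spray, hterm, sum_inv_gCoord_mul hE.isMinkowskiEnergy hy]
  rfl

theorem mixedCurvature_eq (hE : IsFinslerEnergyAt E x) (hy : y ≠ 0) (l i j k : Fin n) :
    mixedCurvature E l i j k x y = -fderiv ℝ (hessian (sprayVector E x)) y
      (EuclideanSpace.single k 1) (EuclideanSpace.single j 1) (EuclideanSpace.single i 1) l := by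
  have hS : ∀ z ≠ 0, ContDiffAt ℝ ∞ (sprayVector E x) z := fun z hz => hE.contDiffAt_sprayVector hz
  have hS1 := fun z hz => contDiffAt_fderiv (hS z hz)
  have hS2 := fun z hz => contDiffAt_fderiv (hS1 z hz)
  have h1 := pd_eq_of_eq_clm (EuclideanSpace.proj l) hS (fun z hz => hE.spray_eq_sprayVector hz l) i
  exact congrArg Neg.neg (pd_eq_of_eq_clm _ hS2 (pd_eq_of_eq_clm _ hS1 h1 j) k y hy)

theorem isQuadratic_of_mixedCurvature_eq {β : Vec n → ℝ} (hE : IsFinslerEnergyAt E x) (hn : 3 ≤ n)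
    (hβ : fderiv ℝ β x ≠ 0)
    (h : ∀ y ≠ 0, ∀ l i j k, mixedCurvature (Finsler.conformalEnergy β E) l i j k x y =
      mixedCurvature E l i j k x y) :
    IsQuadratic (E x) := by
  have hβd : DifferentiableAt ℝ β x := by_contra fun h0 =>
    hβ (fderiv_zero_of_not_differentiableAt h0)
  refine hE.isQuadratic_of_fderiv_hessian_sprayVector_eq (by simpa using hn) hβ fun y hy =>
    ext_single fun k => ext_single fun j => ext_single fun i => PiLp.ext fun l => ?_
  have hP := h y hy l i j k
  rwa [hE.mixedCurvature_eq hy, (hE.conformalEnergy hβd).mixedCurvature_eq hy, neg_inj] at hP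

end IsFinslerEnergyAt

end Coordinates

section Charts

variable {n : ℕ} {M : Type*} [TopologicalSpace M] [ChartedSpace (Vec n) M]
  {F : TangentBundle (𝓡 n) M → ℝ}

theorem coordEnergy_conformalChange (α : M → ℝ) (c : OpenPartialHomeomorph M (Vec n)) :
    coordEnergy (conformalChange α F) c = conformalEnergy (α ∘ c.symm) (coordEnergy F c) := by
  funext x y
  simp only [coordEnergy, conformalChange, conformalEnergy, Function.comp_apply]
  ring

theorem fderiv_comp_chartAt_symm_ne_zero {α : M → ℝ} {q : M}
    (hα : mfderiv (𝓡 n) 𝓘(ℝ, ℝ) α q ≠ 0) :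
    fderiv ℝ (α ∘ (chartAt (Vec n) q).symm) (chartAt (Vec n) q q) ≠ 0 := by
  have hd : MDifferentiableAt (𝓡 n) 𝓘(ℝ, ℝ) α q := by_contra fun h0 =>
    hα (mfderiv_zero_of_not_mdifferentiableAt h0)
  refine fun h0 => hα (hd.mfderiv.trans ?_)
  simp only [mfld_simps, fderivWithin_univ]
  exact h0

variable [IsManifold (𝓡 n) ∞ M]

/-- The trivialization of the tangent bundle over the domain of the chart at `p`. -/
noncomputable abbrev tangentTriv (n : ℕ) {M : Type*} [TopologicalSpace M]
    [ChartedSpace (Vec n) M] [IsManifold (𝓡 n) ∞ M] (p : M) :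
    Bundle.Trivialization (Vec n) (Bundle.TotalSpace.proj : TangentBundle (𝓡 n) M → M) :=
  trivializationAt (Vec n) (TangentSpace (𝓡 n) : M → Type _) p

theorem mfderiv_chartAt_symm (p : M) {x : Vec n} (hx : x ∈ (chartAt (Vec n) p).target) :
    mfderiv (𝓡 n) (𝓡 n) (chartAt (Vec n) p).symm x =
      (tangentTriv n p).symmL ℝ ((chartAt (Vec n) p).symm x) := by
  have hq := (chartAt (Vec n) p).map_target hx
  rw [TangentBundle.symmL_trivializationAt hq]
  simp only [mfld_simps, mfderivWithin_univ]
  let Φ : Vec n → (Vec n →L[ℝ] Vec n) := fun z => mfderiv (𝓡 n) (𝓡 n) (chartAt (Vec n) p).symm z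
  exact congrArg Φ ((chartAt (Vec n) p).right_inv hx).symm

theorem coordEnergy_chartAt (F : TangentBundle (𝓡 n) M → ℝ) (p : M) {x : Vec n}
    (hx : x ∈ (chartAt (Vec n) p).target) :
    coordEnergy F (chartAt (Vec n) p) x =
      energyAt F ((chartAt (Vec n) p).symm x) ∘
        (tangentTriv n p).symmL ℝ ((chartAt (Vec n) p).symm x) := by
  funext y
  rw [coordEnergy, mfderiv_chartAt_symm p hx]
  rfl

theorem exists_equiv_coordEnergy_chartAt (F : TangentBundle (𝓡 n) M → ℝ) (p : M) {x : Vec n}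
    (hx : x ∈ (chartAt (Vec n) p).target) :
    ∃ L : Vec n ≃L[ℝ] Vec n, coordEnergy F (chartAt (Vec n) p) x =
      energyAt F ((chartAt (Vec n) p).symm x) ∘ L := by
  have hq := (chartAt (Vec n) p).map_target hx
  refine ⟨((tangentTriv n p).continuousLinearEquivAt ℝ _ hq).symm, ?_⟩
  rw [coordEnergy_chartAt F p hx, ← (tangentTriv n p).symm_continuousLinearEquivAt_eq hq]
  rfl

theorem contMDiffOn_energyAt_symmL (hF : IsFinslerMetric F) (p : M) :
    ContMDiffOn ((𝓡 n).prod 𝓘(ℝ, Vec n)) 𝓘(ℝ, ℝ) ∞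
      (fun z : M × Vec n => energyAt F z.1 ((tangentTriv n p).symmL ℝ z.1 z.2))
      ((chartAt (Vec n) p).source ×ˢ {0}ᶜ) := by
  let e := tangentTriv n p
  have hsymm : ContMDiffOn ((𝓡 n).prod 𝓘(ℝ, Vec n)) (𝓡 n).tangent ∞
      (fun z : M × Vec n => (⟨z.1, e.symmL ℝ z.1 z.2⟩ : TangentBundle (𝓡 n) M))
      ((chartAt (Vec n) p).source ×ˢ {0}ᶜ) :=
    ((Bundle.Trivialization.contMDiffOn_symm (IB := 𝓡 n) (n := ∞) e).mono fun z hz => by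
      rw [e.target_eq]; exact ⟨hz.1, mem_univ _⟩).congr fun z hz => by
        rw [e.symmL_apply hz.1, e.mk_symm hz.1]
  have hne : ∀ z ∈ (chartAt (Vec n) p).source ×ˢ {0}ᶜ, e.symmL ℝ z.1 z.2 ≠ 0 := fun z hz => by
    rw [← e.symm_continuousLinearEquivAt_eq hz.1]
    exact (e.continuousLinearEquivAt ℝ z.1 hz.1).symm.map_eq_zero_iff.not.2 hz.2
  exact contMDiffOn_const.mul ((hF.smooth.comp hsymm hne).pow 2)

theorem contDiffAt_coordEnergy (hF : IsFinslerMetric F) (p : M) {x y : Vec n}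
    (hx : x ∈ (chartAt (Vec n) p).target) (hy : y ≠ 0) :
    ContDiffAt ℝ ∞ (fun z : Vec n × Vec n => coordEnergy F (chartAt (Vec n) p) z.1 z.2)
      (x, y) := by
  let c := chartAt (Vec n) p
  have hpair : ContMDiffOn 𝓘(ℝ, Vec n × Vec n) ((𝓡 n).prod 𝓘(ℝ, Vec n)) ∞
      (fun z : Vec n × Vec n => (c.symm z.1, z.2)) (c.target ×ˢ {0}ᶜ) :=
    ((contMDiffOn_chart_symm (I := 𝓡 n) (n := ∞) (x := p)).comp
      contDiff_fst.contMDiff.contMDiffOn fun z hz => hz.1).prodMk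
        contDiff_snd.contMDiff.contMDiffOn
  have hcoord := ((contMDiffOn_energyAt_symmL hF p).comp hpair fun z hz =>
    ⟨c.map_target hz.1, hz.2⟩).congr fun z hz => congrFun (coordEnergy_chartAt F p hz.1) z.2
  exact hcoord.contDiffOn.contDiffAt <|
    (c.open_target.prod isOpen_compl_singleton).mem_nhds ⟨hx, hy⟩

theorem exists_equiv_energyAt (F : TangentBundle (𝓡 n) M → ℝ) (q : M) :
    ∃ L : Vec n ≃L[ℝ] Vec n,
      energyAt F q = coordEnergy F (chartAt (Vec n) q) (chartAt (Vec n) q q) ∘ L := by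
  have hq := mem_chart_source (Vec n) q
  obtain ⟨L, hL⟩ := exists_equiv_coordEnergy_chartAt F q ((chartAt (Vec n) q).map_source hq)
  rw [(chartAt (Vec n) q).left_inv hq] at hL
  exact ⟨L.symm, (L.toLinearEquiv.eq_comp_symm _ _).2 hL.symm⟩

theorem isMinkowskiEnergy_energyAt (hF : IsFinslerMetric F) (q : M) :
    IsMinkowskiEnergy (energyAt F q) := by
  obtain ⟨L, hL⟩ := exists_equiv_energyAt F q
  have hsmooth : ∀ v ≠ 0, ContDiffAt ℝ ∞ (energyAt F q) v := fun v hv => by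
    rw [hL]
    exact (contDiffAt_coordEnergy hF q (mem_chart_target (Vec n) q)
      (L.map_eq_zero_iff.not.2 hv)).comp v (f := fun w => (chartAt (Vec n) q q, L w)) (by fun_prop)
  refine ⟨hsmooth, fun t ht v => ?_, fun v hv w hw => ?_⟩
  · have hFt : F ⟨q, t • v⟩ = t * F ⟨q, v⟩ := hF.homogeneous q v t ht
    simp only [energyAt, hFt, smul_eq_mul]
    ring
  · have hpos := hF.stronglyConvex q v hv w hw
    rw [fundamentalForm, fderiv_clm_apply ((contDiffAt_fderiv (hsmooth v hv)).differentiableAt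
      (by simp)) (differentiableAt_const w)] at hpos
    simpa using hpos

theorem isFinslerEnergyAt_coordEnergy (hF : IsFinslerMetric F) (p : M) {x : Vec n}
    (hx : x ∈ (chartAt (Vec n) p).target) :
    IsFinslerEnergyAt (coordEnergy F (chartAt (Vec n) p)) x := by
  obtain ⟨L, hL⟩ := exists_equiv_coordEnergy_chartAt F p hx
  refine isFinslerEnergyAt_of_contDiffAt ?_ fun y hy => contDiffAt_coordEnergy hF p hx hy
  exact hL ▸ (isMinkowskiEnergy_energyAt hF _).comp_equiv L

theorem isQuadratic_energyAt (hF : IsFinslerMetric F) (hn : 3 ≤ n) {α : M → ℝ} {q : M}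
    (hα : mfderiv (𝓡 n) 𝓘(ℝ, ℝ) α q ≠ 0) (hinv : SameMixedCurvature (conformalChange α F) F) :
    IsQuadratic (energyAt F q) := by
  obtain ⟨L, hL⟩ := exists_equiv_energyAt F q
  have hx := mem_chart_target (Vec n) q
  rw [hL]
  refine IsQuadratic.comp_clm ?_ (L : Vec n →L[ℝ] Vec n)
  refine (isFinslerEnergyAt_coordEnergy hF q hx).isQuadratic_of_mixedCurvature_eq hn
    (fderiv_comp_chartAt_symm_ne_zero hα) fun y hy l i j k => ?_
  rw [← coordEnergy_conformalChange]
  exact hinv _ (IsManifold.chart_mem_maximalAtlas q) _ hx y hy l i j k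

end Charts

theorem contMDiffWithinAt_of_forall_clm_apply {X H N : Type*} [NormedAddCommGroup X]
    [NormedSpace ℝ X] [TopologicalSpace H] {I : ModelWithCorners ℝ X H} [TopologicalSpace N]
    [ChartedSpace H N] {V W : Type*} [NormedAddCommGroup V] [NormedSpace ℝ V]
    [FiniteDimensional ℝ V] [NormedAddCommGroup W] [NormedSpace ℝ W] {k : WithTop ℕ∞}
    {f : N → V →L[ℝ] W} {U : Set N} {q : N}
    (h : ∀ v, ContMDiffWithinAt I 𝓘(ℝ, W) k (fun z => f z v) U q) :
    ContMDiffWithinAt I 𝓘(ℝ, V →L[ℝ] W) k f U q := by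
  let e₁ := ContinuousLinearEquiv.ofFinrankEq (finrank_fin_fun ℝ (n := finrank ℝ V)).symm
  let e₂ := (e₁.arrowCongr (.refl ℝ W)).trans (ContinuousLinearEquiv.piRing (Fin (finrank ℝ V)))
  have he₂ : ContMDiffWithinAt I 𝓘(ℝ, Fin (finrank ℝ V) → W) k (e₂ ∘ f) U q :=
    contMDiffWithinAt_pi_space.2 fun i => h _
  simpa [Function.comp_def] using
    e₂.symm.contDiff.contMDiff.contMDiffAt.comp_contMDiffWithinAt q he₂

section Riemannian

variable {n : ℕ} {M : Type*} [TopologicalSpace M] [ChartedSpace (Vec n) M]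
  [IsManifold (𝓡 n) ∞ M] {F : TangentBundle (𝓡 n) M → ℝ}

theorem contMDiffOn_energyAt_symmL_apply (hF : IsFinslerMetric F) (p : M) (y : Vec n) :
    ContMDiffOn (𝓡 n) 𝓘(ℝ, ℝ) ∞ (fun q => energyAt F q ((tangentTriv n p).symmL ℝ q y))
      (chartAt (Vec n) p).source := by
  rcases eq_or_ne y 0 with rfl | hy
  · refine (contMDiffOn_const (c := (0 : ℝ))).congr fun q _ => ?_
    rw [map_zero]
    exact (isMinkowskiEnergy_energyAt hF q).map_zero
  · exact (contMDiffOn_energyAt_symmL hF p).comp (contMDiffOn_id.prodMk contMDiffOn_const)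
      fun q hq => ⟨hq, hy⟩

theorem contMDiffOn_of_eq_polar_energyAt (hF : IsFinslerMetric F) {U : Set M}
    {γ : (q : M) → TangentSpace (𝓡 n) q →L[ℝ] TangentSpace (𝓡 n) q →L[ℝ] ℝ}
    (hγ : ∀ q ∈ U, ∀ u w : Vec n,
      γ q u w = energyAt F q (u + w) - energyAt F q u - energyAt F q w) :
    ContMDiffOn (𝓡 n) ((𝓡 n).prod 𝓘(ℝ, Vec n →L[ℝ] Vec n →L[ℝ] ℝ)) ∞
      (fun q => Bundle.TotalSpace.mk' (Vec n →L[ℝ] Vec n →L[ℝ] ℝ)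
        (E := fun q : M => TangentSpace (𝓡 n) q →L[ℝ] TangentSpace (𝓡 n) q →L[ℝ] ℝ) q (γ q)) U := by
  intro p hp
  let e := tangentTriv n p
  refine (contMDiffWithinAt_hom_bundle _).2 ⟨contMDiffWithinAt_id,
    contMDiffWithinAt_of_forall_clm_apply fun u =>
      contMDiffWithinAt_of_forall_clm_apply fun w => ?_⟩
  have hE : ∀ y, ContMDiffWithinAt (𝓡 n) 𝓘(ℝ, ℝ) ∞ (fun q => energyAt F q (e.symmL ℝ q y)) U p :=
    fun y => ((contMDiffOn_energyAt_symmL_apply hF p y).contMDiffAt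
      (chart_source_mem_nhds (Vec n) p)).contMDiffWithinAt
  refine (((hE (u + w)).sub (hE u)).sub (hE w)).congr_of_eventuallyEq_of_mem ?_ hp
  filter_upwards [self_mem_nhdsWithin,
    mem_nhdsWithin_of_mem_nhds (chart_source_mem_nhds (Vec n) p)] with q hqU hq
  rw [inCoordinates_apply_eq₂ hq hq (mem_univ _)]
  have hadd : e.symmL ℝ q (u + w) = e.symmL ℝ q u + e.symmL ℝ q w := map_add _ u w
  rw [hadd]
  refine Eq.trans ?_ (hγ q hqU (e.symmL ℝ q u) (e.symmL ℝ q w))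
  simp [e, tangentTriv, e.symmL_apply hq]

theorem eq_sqrt_two_mul_energyAt (hF : IsFinslerMetric F) (q : M) (v : Vec n) :
    F ⟨q, v⟩ = Real.sqrt (2 * energyAt F q v) := by
  rw [energyAt, ← mul_assoc, mul_one_div_cancel two_ne_zero, one_mul, Real.sqrt_sq (hF.nonneg _)]

theorem isRiemannianOn_of_isQuadratic (hF : IsFinslerMetric F) {U : Set M}
    (h : ∀ q ∈ U, IsQuadratic (energyAt F q)) : IsRiemannianOn F U := by
  choose! B hBsymm hB using h
  have hpolar : ∀ q ∈ U, ∀ u w : Vec n,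
      ((2 : ℝ) • B q) u w = energyAt F q (u + w) - energyAt F q u - energyAt F q w := by
    intro q hq u w
    simp only [hB q hq, map_add, add_apply, smul_apply, smul_eq_mul, hBsymm q hq w u]
    ring
  have hdiag : ∀ q ∈ U, ∀ v : Vec n, ((2 : ℝ) • B q) v v = 2 * energyAt F q v := fun q hq v => by
    rw [hB q hq, smul_apply, smul_apply, smul_eq_mul]
  refine ⟨fun q => (2 : ℝ) • B q, contMDiffOn_of_eq_polar_energyAt hF hpolar,
    fun q hq => ⟨fun v w => congrArg _ (hBsymm q hq v w), fun v hv => ?_, fun v => ?_⟩⟩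
  · have hpos : 0 < energyAt F q v := (isMinkowskiEnergy_energyAt hF q).pos (V := Vec n) hv
    exact (mul_pos two_pos hpos).trans_eq (hdiag q hq v).symm
  · exact (eq_sqrt_two_mul_energyAt hF q v).trans (congrArg _ (hdiag q hq v).symm)

theorem isOpen_setOf_mfderiv_ne_zero {α : M → ℝ} (hα : ContMDiff (𝓡 n) 𝓘(ℝ, ℝ) 1 α) :
    IsOpen {q | mfderiv (𝓡 n) 𝓘(ℝ, ℝ) α q ≠ 0} := by
  let dα : TangentBundle (𝓡 n) M → ℝ := fun v => mfderiv (𝓡 n) 𝓘(ℝ, ℝ) α v.proj v.2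
  have hdα : Continuous dα := continuous_snd.comp <|
    (tangentBundleModelSpaceHomeomorph 𝓘(ℝ, ℝ)).continuous.comp
      (hα.continuous_tangentMap le_rfl)
  have himage : {q | mfderiv (𝓡 n) 𝓘(ℝ, ℝ) α q ≠ 0} =
      Bundle.TotalSpace.proj '' {v : TangentBundle (𝓡 n) M | dα v ≠ 0} := by
    ext q
    refine ⟨fun hq => ?_, ?_⟩
    · obtain ⟨v, hv⟩ := DFunLike.ne_iff.1 hq
      exact ⟨⟨q, v⟩, hv, rfl⟩
    · rintro ⟨v, hv, rfl⟩
      exact DFunLike.ne_iff.2 ⟨v.2, hv⟩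
  rw [himage]
  exact FiberBundle.isOpenMap_proj (Vec n) (TangentSpace (𝓡 n) : M → Type _) _
    (hdα.isOpen_preimage _ isOpen_compl_singleton)

end Riemannian

end Finsler

theorem theoremA_general {n : ℕ} (hn : 3 ≤ n) {M : Type*} [TopologicalSpace M]
    [ChartedSpace (EuclideanSpace ℝ (Fin n)) M] [IsManifold (𝓡 n) ∞ M]
    (F : TangentBundle (𝓡 n) M → ℝ) (hF : Finsler.IsFinslerMetric F) (α : M → ℝ)
    (hinv : Finsler.SameMixedCurvature (Finsler.conformalChange α F) F) :
    Finsler.IsRiemannianOn F {q | mfderiv (𝓡 n) 𝓘(ℝ, ℝ) α q ≠ 0} :=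
  Finsler.isRiemannianOn_of_isQuadratic hF fun _ hq =>
    Finsler.isQuadratic_energyAt hF hn hq hinv

theorem theoremA {n : ℕ} (hn : 3 ≤ n) {M : Type*} [TopologicalSpace M]
    [ChartedSpace (EuclideanSpace ℝ (Fin n)) M] [IsManifold (𝓡 n) ∞ M]
    (F : TangentBundle (𝓡 n) M → ℝ) (hF : Finsler.IsFinslerMetric F)
    (α : M → ℝ) (hα : ContMDiff (𝓡 n) 𝓘(ℝ, ℝ) ∞ α)
    (p : M) (hp : mfderiv (𝓡 n) 𝓘(ℝ, ℝ) α p ≠ 0)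
    (hcurv : Finsler.PositivelyCurvedIndicatrix F p)
    (hinv : Finsler.SameMixedCurvature (Finsler.conformalChange α F) F) :
    ∃ U : Set M, IsOpen U ∧ p ∈ U ∧ Finsler.IsRiemannianOn F U := by
  exact ⟨{q | mfderiv (𝓡 n) 𝓘(ℝ, ℝ) α q ≠ 0},
    Finsler.isOpen_setOf_mfderiv_ne_zero (hα.of_le (by simp)), hp, theoremA_general hn F hF α hinv⟩
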